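/- **Setting.** Let the vocabulary be $[V]=\{1,\dots,V\}$ with $V\ge 2$, and let an autoregressive language model $p$ assign to each finite string a probability distribution on $[V]$. A key is a pair $\xi=(\pi,u)$; its law $\nu$ makes $\pi$ a uniformly random permutation of $[V]$ and $u\sim\mathrm{Unif}[0,1]$ independent of $\pi$. Consider a sequence of detection problems with $n\to\infty$; the quantities $m,B,n_0,T$, the law of the prompt, the transformation $\mathcal T$ and the weights may change along the sequence, and $1\le B\le\min(n,m)$. In each of them, the prompt $y_{-n_0:0}$ is a random (or deterministic) string, independent of the keys $\xi_1,\dots,\xi_n$, which are i.i.d. with law $\nu$. With $\mu_i=p(\cdot\mid y_{-n_0:i-1})$, inverse transform sampling (ITS) generates, for $i=1,\dots,n$, $$y_i=\pi_i^{-1}\bigl(\min\{\pi_i(l):\mu_i(\{j:\pi_i(j)\le\pi_i(l)\})\ge u_i\}\bigr).$$ The published text is $\widetilde y_{1:m}=\mathcal T(y_{-n_0:n})$ for a function $\mathcal T$, and $w_1,\dots,w_n\ge 0$ are weights, which may be functions of $y_{-n_0:n}$. For $1\le a\le n-B+1$ and $1\le b\le m-B+1$ put $$\phi(\xi_{a:a+B-1},\widetilde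 y_{b:b+B-1})=\frac1B\sum_{i=0}^{B-1}w_{a+i}\Bigl(u_{a+i}-\frac12\Bigr)\Bigl(\frac{\pi_{a+i}(\widetilde y_{b+i})-1}{V-1}-\frac12\Bigr),$$ $$\mathcal M(\xi_{1:n},\widetilde y_{1:m})=\max_{a,b}\phi(\xi_{a:a+B-1},\widetilde y_{b:b+B-1}).$$ Let $\xi^{(1)}_{1:n},\dots,\xi^{(T)}_{1:n}$ be independent key sequences with i.i.d. entries of law $\nu$, independent of the prompt and of $\xi_{1:n}$, and let $$\mathsf p_T=\frac1{T+1}\Bigl(1+\sum_{t=1}^T\mathbf 1\{\mathcal M(\xi_{1:n},\widetilde y_{1:m})\le\mathcal M(\xi^{(t)}_{1:n},\widetilde y_{1:m})\}\Bigr)$$ (the same weights being used for every key sequence). Put $N=\max\{n,m\}$, $\Omega_{\max}=\max_{1\le i\le n}w_i^2$, $C_{N,B}=\sqrt{\Omega_{\max}}\sqrt{\log(N)/B}$ and $\mathcal F_m=\sigma(y_{-n_0:0},\widetilde y_{1:m})$. **Theorem.** There is an absolute constant $C_0>0$ such that for every level $\alpha\in(0,1)$ and every $\epsilon>0$ there is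 a constant $C_1>0$ depending only on $\alpha$ and $\epsilon$, with $C_1=C_0$ whenever $3\epsilon<\alpha$, for which the following holds. If $T>2/\epsilon-1$ throughout and $$C_{N,B}^{-1}\max_{a,b}\mathbb E\bigl[\phi(\xi_{a:a+B-1},\widetilde y_{b:b+B-1})\,\big|\,\widetilde y_{1:m},y_{-n_0:n}\bigr]\to+\infty$$ in probability (where the left side is read as $0$ if $C_{N,B}=0$), then the randomization test that rejects when $\mathsf p_T\le\alpha$ satisfies $$P(\mathsf p_T\le\alpha\mid\mathcal F_m)\ge 1-C_1\exp(-2T\epsilon^2)+o(1),$$ where $o(1)$ denotes a term that tends to $0$ in probability; that is, for every $\delta>0$ the probability that the left side is smaller than $1-C_1\exp(-2T\epsilon^2)-\delta$ tends to $0$. -/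

import Mathlib

open MeasureTheory ProbabilityTheory Filter Topology

noncomputable section

namespace ITSWatermark

/-- Permutations of the vocabulary carry the discrete sigma-algebra. -/
instance instMeasurableSpacePerm (V : ℕ) : MeasurableSpace (Equiv.Perm (Fin V)) := ⊤

/-- A watermark key `ξ = (π, u)`: a permutation of the vocabulary and a number in `[0,1]`.
The vocabulary of size `V` is `Fin V`, so ranks run over `0, …, V - 1`. -/
abbrev Key (V : ℕ) : Type := Equiv.Perm (Fin V) × unitInterval

/-- The key law `ν`: `π` uniform on all permutations, `u` uniform on `[0,1]`, independent. -/
def keyLaw (V : ℕ) : Measure (Key V) :=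
  (PMF.uniformOfFintype (Equiv.Perm (Fin V))).toMeasure.prod volume

/-- An autoregressive language model: a string (oldest token first) is mapped to the
distribution of the next token. -/
abbrev LanguageModel (V : ℕ) : Type := List (Fin V) → PMF (Fin V)

/-- `μ(j : π(j) ≤ r)`. -/
def rankCDF {V : ℕ} (π : Equiv.Perm (Fin V)) (μ : PMF (Fin V)) (r : Fin V) : ℝ :=
  ∑ j ∈ Finset.univ.filter (fun j => π j ≤ r), (μ j).toReal

open Classical in
/-- The set `{π(l) : μ(j : π(j) ≤ π(l)) ≥ u}`. -/
def admissibleRanks {V : ℕ} (ξ : Key V) (μ : PMF (Fin V)) : Finset (Fin V) :=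
  (Finset.univ.filter (fun l => (ξ.2 : ℝ) ≤ rankCDF ξ.1 μ (ξ.1 l))).image ξ.1

theorem admissibleRanks_nonempty {V : ℕ} (ξ : Key V) (μ : PMF (Fin V)) :
    (admissibleRanks ξ μ).Nonempty := by
  classical
  obtain ⟨k, -⟩ := μ.support_nonempty
  have : NeZero V := ⟨fun h => by subst h; exact k.elim0⟩
  refine Finset.Nonempty.image ⟨ξ.1.symm ⊤, ?_⟩ _
  have hsum : rankCDF ξ.1 μ ⊤ = 1 := by
    have h1 : ∑ j, μ j = 1 := by
      rw [← tsum_fintype (L := .unconditional _)]; exact μ.tsum_coe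
    unfold rankCDF
    rw [Finset.filter_true_of_mem (fun j _ => le_top),
      ← ENNReal.toReal_sum (fun j _ => μ.apply_ne_top j), h1, ENNReal.toReal_one]
  simp only [Finset.mem_filter, Finset.mem_univ, true_and, Equiv.apply_symm_apply, hsum]
  exact ξ.2.2.2

/-- The decoder
`Γ((π, u), μ) = π⁻¹ (min {π(l) : μ(j : π(j) ≤ π(l)) ≥ u})`. -/
def decode {V : ℕ} (ξ : Key V) (μ : PMF (Fin V)) : Fin V :=
  ξ.1.symm ((admissibleRanks ξ μ).min' (admissibleRanks_nonempty ξ μ))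

/-- The watermarked text: `y_i = Γ(ξ_i, p(· | prompt, y_1, …, y_{i-1}))`. -/
def generate {V n : ℕ} (p : LanguageModel V) (prompt : List (Fin V)) (ξ : Fin n → Key V)
    (i : Fin n) : Fin V :=
  decode (ξ i) (p (prompt ++
    List.ofFn (fun j : Fin i.val => generate p prompt ξ ⟨j.val, j.isLt.trans i.isLt⟩)))
termination_by i.val
decreasing_by exact j.isLt

/-- The segment of length `B` that starts at position `a`. -/
def window {α : Type*} {n B : ℕ} (hB : B ≤ n) (a : Fin (n - B + 1)) (f : Fin n → α) :
    Fin B → α :=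
  fun i => f ⟨a.val + i.val, by have := a.isLt; have := i.isLt; omega⟩

/-- The weighted statistic of a key segment and a text segment of length `B`,
`φ = B⁻¹ ∑ w_i (u_i - 1/2) (rank_i / (V - 1) - 1/2)`, where `rank_i = π_i(y_i)` is counted
from `0`. -/
def weightedStat {V B : ℕ} (w : Fin B → ℝ) (ξ : Fin B → Key V) (y : Fin B → Fin V) : ℝ :=
  1 / (B : ℝ) * ∑ i, w i * (((ξ i).2 : ℝ) - 1 / 2) *
    ((((ξ i).1 (y i)).val : ℝ) / ((V : ℝ) - 1) - 1 / 2)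

/-- One detection problem over the vocabulary `Fin V`. -/
structure Experiment (V : ℕ) where
  /-- length of the key and of the generated text -/
  n : ℕ
  /-- length of the published text -/
  m : ℕ
  /-- window length -/
  B : ℕ
  /-- the prompt is `y_{-n₀}, …, y_0` -/
  n₀ : ℕ
  /-- number of randomly drawn key sequences in the randomization test -/
  T : ℕ
  one_le_B : 1 ≤ B
  B_le_n : B ≤ n
  B_le_m : B ≤ m
  /-- law of the prompt (a point mass for a deterministic prompt) -/
  promptLaw : PMF (Fin (n₀ + 1) → Fin V)
  /-- the transformation that turns the generated text into the published text -/
  edit : (Fin (n₀ + 1) → Fin V) → (Fin n → Fin V) → (Fin m → Fin V)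
  /-- the weights `w_1, …, w_n`; like `(1 - p_i) / p_i` they may depend on prompt and text -/
  weight : (Fin (n₀ + 1) → Fin V) → (Fin n → Fin V) → (Fin n → ℝ)
  weight_nonneg : ∀ x y i, 0 ≤ weight x y i

namespace Experiment

variable {V : ℕ} (E : Experiment V)

/-- Outcomes: the prompt, the key sequence `ξ`, and the `T` fresh key sequences `ξ^(t)`. -/
abbrev Sample : Type :=
  (Fin (E.n₀ + 1) → Fin V) × (Fin E.n → Key V) × (Fin E.T → Fin E.n → Key V)

/-- The prompt and all keys are independent, and every key has law `ν`. -/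
def prob : Measure E.Sample :=
  E.promptLaw.toMeasure.prod
    ((Measure.pi fun _ => keyLaw V).prod (Measure.pi fun _ => Measure.pi fun _ => keyLaw V))

/-- The generated text `y_{1:n}`. -/
def text (p : LanguageModel V) (ω : E.Sample) : Fin E.n → Fin V :=
  generate p (List.ofFn ω.1) ω.2.1

/-- The published text `ỹ_{1:m}`. -/
def published (p : LanguageModel V) (ω : E.Sample) : Fin E.m → Fin V :=
  E.edit ω.1 (E.text p ω)

/-- The realized weights. -/
def weights (p : LanguageModel V) (ω : E.Sample) : Fin E.n → ℝ :=
  E.weight ω.1 (E.text p ω)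

/-- `φ(ξ_{a:a+B-1}, ỹ_{b:b+B-1}; w_{a:a+B-1})`. -/
def windowStat (w : Fin E.n → ℝ) (ξ : Fin E.n → Key V) (y : Fin E.m → Fin V)
    (a : Fin (E.n - E.B + 1)) (b : Fin (E.m - E.B + 1)) : ℝ :=
  weightedStat (window E.B_le_n a w) (window E.B_le_n a ξ) (window E.B_le_m b y)

/-- The scanning maximum statistic. -/
def maxStat (w : Fin E.n → ℝ) (ξ : Fin E.n → Key V) (y : Fin E.m → Fin V) : ℝ :=
  Finset.univ.sup' Finset.univ_nonempty
    (fun ab : Fin (E.n - E.B + 1) × Fin (E.m - E.B + 1) => E.windowStat w ξ y ab.1 ab.2)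

open Classical in
/-- The randomization p-value. -/
def pValue (p : LanguageModel V) (ω : E.Sample) : ℝ :=
  1 / ((E.T : ℝ) + 1) * (1 + ∑ t : Fin E.T,
    if E.maxStat (E.weights p ω) ω.2.1 (E.published p ω)
        ≤ E.maxStat (E.weights p ω) (ω.2.2 t) (E.published p ω) then (1 : ℝ) else 0)

theorem univ_nonempty_n : (Finset.univ : Finset (Fin E.n)).Nonempty :=
  ⟨⟨0, E.one_le_B.trans E.B_le_n⟩, Finset.mem_univ _⟩

/-- `Ω_max = max_i w_i²`. -/
def omegaMax (p : LanguageModel V) (ω : E.Sample) : ℝ :=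
  Finset.univ.sup' E.univ_nonempty_n (fun i => E.weights p ω i ^ 2)

/-- `C_{N,B} = √Ω_max √(log N / B)` with `N = max n m`. -/
def scale (p : LanguageModel V) (ω : E.Sample) : ℝ :=
  √(E.omegaMax p ω) * √(Real.log ((max E.n E.m : ℕ) : ℝ) / (E.B : ℝ))

/-- The sigma-algebra of the published text, the prompt and the generated text. -/
abbrev fullInfo (p : LanguageModel V) : MeasurableSpace E.Sample :=
  MeasurableSpace.comap (fun ω => (E.published p ω, ω.1, E.text p ω)) ⊤

/-- The sigma-algebra `F_m` of the prompt and the published text. -/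
abbrev publicInfo (p : LanguageModel V) : MeasurableSpace E.Sample :=
  MeasurableSpace.comap (fun ω => (ω.1, E.published p ω)) ⊤

/-- `max_{a,b} E[φ(ξ_{a:a+B-1}, ỹ_{b:b+B-1}) | ỹ_{1:m}, y_{-n₀:n}]`. -/
def maxCondMean (p : LanguageModel V) (ω : E.Sample) : ℝ :=
  Finset.univ.sup' Finset.univ_nonempty
    (fun ab : Fin (E.n - E.B + 1) × Fin (E.m - E.B + 1) =>
      (E.prob[fun ω' => E.windowStat (E.weights p ω') ω'.2.1 (E.published p ω') ab.1 ab.2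
        | E.fullInfo p]) ω)

/-- The conditional power `P(p_T ≤ α | F_m)`. -/
def condPower (p : LanguageModel V) (α : ℝ) : E.Sample → ℝ :=
  E.prob⟦{ω | E.pValue p ω ≤ α}|E.publicInfo p⟧

end Experiment

end ITSWatermark

end

/-!
Conditionally on the prompt and the generated text, the keys remain independent, each restricted to
the event that it produced its token, and the fresh key sequences keep their law.  Hence every
window statistic is conditionally sub-Gaussian with variance proxy `Ω_max / (16 B)`, under the true
and under the fresh keys.  At the scale `C_{N,B}` its tail is `N⁻⁸`, which beats the union bound
over the at most `N²` windows.  Once the best conditional mean exceeds `2 C_{N,B}`, a fresh maximum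
therefore reaches the true one with probability at most `2 / n`.  The p-value is an affine function
of the number of such exceedances, and Markov's inequality, for their number and then for the
conditional probability, gives the result.
-/

noncomputable section

namespace ITSWatermark

section Probability

variable {Ω : Type*} {m₀ : MeasurableSpace Ω} {μ : Measure Ω}

theorem cond_prod_prod {Ω' : Type*} [MeasurableSpace Ω'] (μ : Measure Ω) (ν : Measure Ω')
    [IsFiniteMeasure μ] [IsFiniteMeasure ν] (s : Set Ω) (t : Set Ω') :
    (μ.prod ν)[|s ×ˢ t] = (μ[|s]).prod (ν[|t]) := by
  have hinv : (μ s * ν t)⁻¹ = (μ s)⁻¹ * (ν t)⁻¹ :=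
    ENNReal.mul_inv (.inr (measure_ne_top _ _)) (.inl (measure_ne_top _ _))
  simp only [ProbabilityTheory.cond]
  rw [Measure.prod_prod, hinv, ← Measure.prod_restrict, Measure.prod_smul_left,
    Measure.prod_smul_right, smul_smul]

theorem cond_pi_univ_pi {ι : Type*} [Fintype ι] {α : ι → Type*} [∀ i, MeasurableSpace (α i)]
    (μ : ∀ i, Measure (α i)) [∀ i, IsFiniteMeasure (μ i)] {s : ∀ i, Set (α i)}
    (hs : ∀ i, MeasurableSet (s i)) :
    (Measure.pi μ)[|Set.univ.pi s] = Measure.pi fun i => (μ i)[|s i] := by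
  refine (Measure.pi_eq fun t _ => ?_).symm
  rw [cond_apply (MeasurableSet.univ_pi hs), ← Set.pi_inter_distrib, Measure.pi_pi, Measure.pi_pi,
    ENNReal.prod_inv_distrib fun i _ j _ _ => .inr (measure_ne_top _ _),
    ← Finset.prod_mul_distrib]
  exact Finset.prod_congr rfl fun i _ => (cond_apply (hs i) _ _).symm

theorem condExp_comap_apply [IsFiniteMeasure μ] {α : Type*} {mα : MeasurableSpace α}
    [MeasurableSingletonClass α] {X : Ω → α} (hX : Measurable X) {f : Ω → ℝ}
    (hf : Integrable f μ) {ω : Ω} (hω : μ (X ⁻¹' {X ω}) ≠ 0) :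
    (μ[f | mα.comap X]) ω = ∫ ω', f ω' ∂μ[|X ← X ω] := by
  have hconst : ∀ ω' ∈ X ⁻¹' {X ω}, (μ[f | mα.comap X]) ω' = (μ[f | mα.comap X]) ω :=
    fun ω' hω' => stronglyMeasurable_condExp.measurable.factorsThrough hω'
  have hset := setIntegral_condExp hX.comap_le hf ⟨{X ω}, measurableSet_singleton _, rfl⟩
  rw [setIntegral_congr_fun (hX (measurableSet_singleton _)) hconst, setIntegral_const,
    smul_eq_mul] at hset
  rw [ProbabilityTheory.cond, integral_smul_measure, ← hset, ENNReal.toReal_inv,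
    ← measureReal_def, smul_eq_mul, inv_mul_cancel_left₀ ((measureReal_ne_zero_iff).2 hω)]

theorem measureReal_le_add_of_cond_fiber_le [IsProbabilityMeasure μ] {α : Type*} [Finite α]
    [MeasurableSpace α] [DiscreteMeasurableSpace α] {X : Ω → α} (hX : Measurable X)
    {A H : Set Ω} {r : ℝ} (hr : 0 ≤ r)
    (h : ∀ ω ∉ H, μ (X ⁻¹' {X ω}) ≠ 0 → (μ[|X ← X ω]).real A ≤ r) :
    μ.real A ≤ μ.real H + r := by
  have := Fintype.ofFinite α
  have htotal (s : Set Ω) : ∑ x, μ.real (X ⁻¹' {x}) * (μ[|X ← x]).real s = μ.real s := by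
    conv_rhs => rw [← sum_meas_smul_cond_fiber hX μ]
    simp [measureReal_def, ENNReal.toReal_sum, ENNReal.mul_eq_top, measure_ne_top]
  have hfiber (x : α) : μ.real (X ⁻¹' {x}) * (μ[|X ← x]).real (A \ H)
      ≤ μ.real (X ⁻¹' {x}) * r := by
    obtain h0 | h0 := eq_or_ne (μ (X ⁻¹' {x})) 0
    · simp [measureReal_def, h0]
    refine mul_le_mul_of_nonneg_left ?_ measureReal_nonneg
    by_cases hx : ∃ ω ∉ H, X ω = x
    · obtain ⟨ω, hω, rfl⟩ := hx
      exact (measureReal_mono Set.sdiff_subset).trans (h ω hω h0)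
    · have hempty : X ⁻¹' {x} ∩ (A \ H) = ∅ :=
        Set.eq_empty_of_forall_notMem fun ω hω => hx ⟨ω, hω.2.2, hω.1⟩
      rwa [measureReal_def, cond_apply (hX (measurableSet_singleton x)), hempty, measure_empty,
        mul_zero, ENNReal.toReal_zero]
  have hdiff : μ.real (A \ H) ≤ r := by
    calc μ.real (A \ H) ≤ ∑ x, μ.real (X ⁻¹' {x}) * r :=
          (htotal _).symm.trans_le (Finset.sum_le_sum fun x _ => hfiber x)
      _ = r := by
          rw [← Finset.sum_mul, sum_measureReal_preimage_singleton _ fun x _ =>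
            hX (measurableSet_singleton x)]
          simp
  calc μ.real A ≤ μ.real (H ∪ (A \ H)) := measureReal_mono (by simp [Set.subset_union_right])
    _ ≤ μ.real H + μ.real (A \ H) := measureReal_union_le _ _
    _ ≤ μ.real H + r := by gcongr

theorem mul_measureReal_le_sum_indicator_le [IsFiniteMeasure μ] {ι : Type*} [Fintype ι]
    {A : ι → Set Ω} (hA : ∀ i, MeasurableSet (A i)) (c : ℝ) :
    c * μ.real {ω | c ≤ ∑ i, (A i).indicator (fun _ => (1 : ℝ)) ω} ≤ ∑ i, μ.real (A i) := by
  have hint (i : ι) : Integrable ((A i).indicator fun _ => (1 : ℝ)) μ :=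
    (integrable_const _).indicator (hA i)
  refine (mul_meas_ge_le_integral_of_nonneg (ae_of_all _ fun ω => Finset.sum_nonneg fun i _ =>
    Set.indicator_nonneg (fun _ _ => zero_le_one) _)
    (integrable_finsetSum _ fun i _ => hint i) c).trans_eq ?_
  simp only [integral_finsetSum _ fun i _ => hint i, integral_indicator_const _ (hA _),
    smul_eq_mul, mul_one]

theorem measureReal_condProb_lt_one_sub_le {Ω : Type*} {m m₀ : MeasurableSpace Ω}
    {μ : Measure Ω} [IsProbabilityMeasure μ] (hm : m ≤ m₀) {S : Set Ω} (hS : MeasurableSet S)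
    {δ : ℝ} (hδ : 0 < δ) :
    μ.real {ω | (μ⟦S|m⟧) ω < 1 - δ} ≤ μ.real Sᶜ / δ := by
  have hint : Integrable (S.indicator fun _ => (1 : ℝ)) μ := (integrable_const _).indicator hS
  have hle_one : ∀ᵐ ω ∂μ, (μ⟦S|m⟧) ω ≤ 1 := by
    have hmono := condExp_mono (m := m) hint (integrable_const (1 : ℝ))
      (ae_of_all _ fun ω => Set.indicator_le_self' (fun _ _ => zero_le_one) ω)
    rwa [condExp_const hm] at hmono
  have hmarkov := mul_meas_ge_le_integral_of_nonneg (μ := μ) (f := fun ω => 1 - (μ⟦S|m⟧) ω)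
    (hle_one.mono fun ω hω => sub_nonneg.2 hω) ((integrable_const _).sub integrable_condExp) δ
  rw [integral_sub (integrable_const _) integrable_condExp, integral_condExp hm,
    integral_indicator_const _ hS, integral_const, probReal_univ, one_smul, smul_eq_mul, mul_one,
    ← probReal_compl_eq_one_sub hS] at hmarkov
  rw [le_div_iff₀' hδ]
  refine (mul_le_mul_of_nonneg_left (measureReal_mono ?_) hδ.le).trans hmarkov
  exact fun ω (hω : (μ⟦S|m⟧) ω < 1 - δ) => (lt_sub_comm.1 hω).le

theorem measureReal_ge_le_of_hasSubgaussianMGF {X : Ω → ℝ} {W : NNReal} {B : ℕ}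
    (hX : HasSubgaussianMGF X (W ^ 2 / (16 * B)) μ) (hW : W ≠ 0) (hB : B ≠ 0) {L : ℝ}
    (hL : 0 ≤ L) : μ.real {ω | W * √(L / B) ≤ X ω} ≤ Real.exp (-(8 * L)) := by
  refine (hX.measure_ge_le (by positivity)).trans_eq ?_
  rw [mul_pow, Real.sq_sqrt (by positivity)]
  push_cast
  field_simp
  ring_nf

theorem exp_neg_eight_mul_log_add_le {n N : ℕ} (hn : 1 ≤ n) (hN : n ≤ N) :
    Real.exp (-(8 * Real.log N)) + (N : ℝ) ^ 2 * Real.exp (-(8 * Real.log N)) ≤ 2 / n := by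
  have hn_pos : (0 : ℝ) < n := by positivity
  have hnN : (n : ℝ) ≤ N := by exact_mod_cast hN
  have hN_one : (1 : ℝ) ≤ N := by exact_mod_cast hn.trans hN
  have hexp : Real.exp (-(8 * Real.log N)) = ((N : ℝ) ^ 8)⁻¹ := by
    rw [Real.exp_neg, mul_comm, Real.exp_mul, Real.exp_log (by linarith)]
    norm_cast
  have hinv {j : ℕ} (hj : j ≠ 0) : ((N : ℝ) ^ j)⁻¹ ≤ (n : ℝ)⁻¹ :=
    inv_anti₀ hn_pos (hnN.trans (le_self_pow₀ hN_one hj))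
  calc _ = ((N : ℝ) ^ 8)⁻¹ + ((N : ℝ) ^ 6)⁻¹ := by rw [hexp]; field_simp
    _ ≤ (n : ℝ)⁻¹ + (n : ℝ)⁻¹ := add_le_add (hinv (by norm_num)) (hinv (by norm_num))
    _ = 2 / n := by ring

end Probability

section Key

variable {V : ℕ}

/-- The factor `(u - 1/2) (π(v) / (V - 1) - 1/2)` of the weight in the summand of `weightedStat`
that belongs to the key `ξ = (π, u)` and the token `v`. -/
def tokenScore (v : Fin V) (ξ : Key V) : ℝ :=
  ((ξ.2 : ℝ) - 1 / 2) * (((ξ.1 v).val : ℝ) / ((V : ℝ) - 1) - 1 / 2)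

theorem weightedStat_eq {B : ℕ} (w : Fin B → ℝ) (ξ : Fin B → Key V) (y : Fin B → Fin V) :
    weightedStat w ξ y = 1 / (B : ℝ) * ∑ i, w i * tokenScore (y i) (ξ i) := by
  simp only [weightedStat, tokenScore, mul_assoc]

instance (V : ℕ) : DiscreteMeasurableSpace (Equiv.Perm (Fin V)) :=
  ⟨fun _ => trivial⟩

instance (V : ℕ) : IsProbabilityMeasure (keyLaw V) := by
  unfold keyLaw; infer_instance

theorem measurable_tokenScore {Ω : Type*} [MeasurableSpace Ω] {y : Ω → Fin V} {ξ : Ω → Key V}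
    (hy : Measurable y) (hξ : Measurable ξ) : Measurable fun ω => tokenScore (y ω) (ξ ω) := by
  have hrank : Measurable fun ω => (((ξ ω).1 (y ω)).val : ℝ) :=
    (measurable_of_countable fun q : Equiv.Perm (Fin V) × Fin V => ((q.1 q.2).val : ℝ)).comp
      (hξ.fst.prodMk hy)
  have hu : Measurable fun ω => ((ξ ω).2 : ℝ) := measurable_subtype_coe.comp hξ.snd
  exact (hu.sub_const _).mul ((hrank.div_const _).sub_const _)

theorem abs_tokenScore_le (v : Fin V) (ξ : Key V) : |tokenScore v ξ| ≤ 1 / 4 := by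
  have hrank : ((ξ.1 v).val : ℝ) + 1 ≤ V := by exact_mod_cast (ξ.1 v).isLt
  have hV : (0 : ℝ) ≤ V - 1 := by linarith [(Nat.cast_nonneg (ξ.1 v).val : (0 : ℝ) ≤ _)]
  have hcentre {x : ℝ} (h₀ : 0 ≤ x) (h₁ : x ≤ 1) : |x - 1 / 2| ≤ 1 / 2 :=
    abs_le.2 ⟨by linarith, by linarith⟩
  calc |tokenScore v ξ| ≤ 1 / 2 * (1 / 2) := by
        rw [tokenScore, abs_mul]
        exact mul_le_mul (hcentre ξ.2.2.1 ξ.2.2.2)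
          (hcentre (by positivity) (div_le_one_of_le₀ (by linarith) hV)) (abs_nonneg _) (by simp)
    _ = 1 / 4 := by norm_num

theorem integral_tokenScore_keyLaw (v : Fin V) : ∫ ξ, tokenScore v ξ ∂keyLaw V = 0 := by
  have hu : ∫ u : unitInterval, ((u : ℝ) - 1 / 2) = 0 := by
    rw [unitInterval.volume_def,
      integral_subtype_comap measurableSet_Icc (fun u : ℝ => u - 1 / 2),
      integral_Icc_eq_integral_Ioc, ← intervalIntegral.integral_of_le zero_le_one]
    simp
  have hmul := integral_prod_mul (μ := (PMF.uniformOfFintype (Equiv.Perm (Fin V))).toMeasure)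
    (ν := (volume : Measure unitInterval))
    (fun π => ((π v).val : ℝ) / ((V : ℝ) - 1) - 1 / 2) (fun u => (u : ℝ) - 1 / 2)
  rw [hu, mul_zero] at hmul
  simpa only [tokenScore, keyLaw, mul_comm] using hmul

variable {B : ℕ} {Ω : Type*} [MeasurableSpace Ω] {P : Measure Ω} {ξ : Fin B → Ω → Key V}

theorem integral_weightedStat_of_hasLaw_keyLaw
    (hξ : ∀ i, HasLaw (ξ i) (keyLaw V) P) (w : Fin B → ℝ) (y : Fin B → Fin V) :
    ∫ ω, weightedStat w (ξ · ω) y ∂P = 0 := by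
  have hscore (v : Fin V) : Measurable (tokenScore v) :=
    measurable_tokenScore measurable_const measurable_id
  have hint (i : Fin B) : Integrable (fun ω => w i * tokenScore (y i) (ξ i ω)) P := by
    have := (hξ i).isFiniteMeasure
    exact (Integrable.of_bound
      ((hscore _).comp_aemeasurable (hξ i).aemeasurable).aestronglyMeasurable _
      (ae_of_all _ fun ω => abs_tokenScore_le (y i) (ξ i ω))).const_mul _
  have hzero (i : Fin B) : ∫ ω, w i * tokenScore (y i) (ξ i ω) ∂P = 0 := by
    have hlaw := (hξ i).integral_comp (hscore (y i)).aestronglyMeasurable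
    rw [integral_tokenScore_keyLaw] at hlaw
    rw [integral_const_mul]
    exact mul_eq_zero_of_right _ hlaw
  simp only [weightedStat_eq, integral_const_mul, integral_finsetSum _ fun i _ => hint i, hzero,
    Finset.sum_const_zero, mul_zero]

theorem hasSubgaussianMGF_weightedStat (hξ : ∀ i, Measurable (ξ i)) (hind : iIndepFun ξ P)
    {w : Fin B → ℝ} {W : NNReal} (hw : ∀ i, |w i| ≤ W) (y : Fin B → Fin V) :
    HasSubgaussianMGF
      (fun ω => weightedStat w (ξ · ω) y - ∫ ω', weightedStat w (ξ · ω') y ∂P)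
      (W ^ 2 / (16 * B)) P := by
  have := hind.isProbabilityMeasure
  let X (i : Fin B) (k : Key V) : ℝ := w i * tokenScore (y i) k
  have hX (i : Fin B) : Measurable (X i) :=
    (measurable_tokenScore measurable_const measurable_id).const_mul _
  have hX_mem (i : Fin B) (ω : Ω) : X i (ξ i ω) ∈ Set.Icc (-(W / 4) : ℝ) (W / 4) := by
    rw [Set.mem_Icc, ← abs_le, abs_mul, div_eq_mul_one_div]
    exact mul_le_mul (hw i) (abs_tokenScore_le _ _) (abs_nonneg _) W.coe_nonneg
  have hX_ae (i : Fin B) : AEMeasurable (fun ω => X i (ξ i ω)) P :=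
    ((hX i).comp (hξ i)).aemeasurable
  have hX_int (i : Fin B) : Integrable (fun ω => X i (ξ i ω)) P :=
    Integrable.of_mem_Icc _ _ (hX_ae i) (ae_of_all _ (hX_mem i))
  have hsum := HasSubgaussianMGF.sum_of_iIndepFun
    (hind.comp (fun i k => X i k - ∫ ω, X i (ξ i ω) ∂P) fun i => (hX i).sub_const _)
    (s := Finset.univ) fun i _ =>
      hasSubgaussianMGF_of_mem_Icc (hX_ae i) (ae_of_all _ (hX_mem i))
  convert hsum.const_mul (1 / B : ℝ) using 1
  · funext ω
    simp only [weightedStat_eq, integral_const_mul, Function.comp_apply, Finset.sum_sub_distrib,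
      integral_finsetSum _ fun i _ => hX_int i, mul_sub, X]
  · ext
    change _ = (1 / B : ℝ) ^ 2 * ((∑ _ : Fin B, (‖(W / 4 - -(W / 4) : ℝ)‖₊ / 2) ^ 2 : NNReal) : ℝ)
    have hlength : ‖(W / 4 - -(W / 4) : ℝ)‖ = W / 2 := by
      rw [Real.norm_of_nonneg (by linarith [W.coe_nonneg])]
      ring
    push_cast
    rw [hlength, Finset.sum_const, Finset.card_univ, Fintype.card_fin, nsmul_eq_mul]
    obtain rfl | hB := eq_or_ne B 0
    · simp
    · field_simp
      ring

end Key

section Generate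

variable {V : ℕ}

theorem decode_eq_iff (ξ : Key V) (μ : PMF (Fin V)) (v : Fin V) :
    decode ξ μ = v ↔ (ξ.2 : ℝ) ≤ rankCDF ξ.1 μ (ξ.1 v) ∧
      ∀ l, (ξ.2 : ℝ) ≤ rankCDF ξ.1 μ (ξ.1 l) → ξ.1 v ≤ ξ.1 l := by
  have hmem (l : Fin V) : ξ.1 l ∈ admissibleRanks ξ μ ↔ (ξ.2 : ℝ) ≤ rankCDF ξ.1 μ (ξ.1 l) := by
    simp [admissibleRanks]
  rw [decode, Equiv.symm_apply_eq, Finset.min'_eq_iff, ξ.1.surjective.forall]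
  simp only [hmem]

theorem measurable_decode (μ : PMF (Fin V)) : Measurable fun ξ : Key V => decode ξ μ := by
  have hadmissible (l : Fin V) :
      Measurable fun ξ : Key V => (ξ.2 : ℝ) ≤ rankCDF ξ.1 μ (ξ.1 l) :=
    Measurable.le' (measurable_subtype_coe.comp measurable_snd)
      ((measurable_of_countable fun π : Equiv.Perm (Fin V) => rankCDF π μ (π l)).comp
        measurable_fst)
  have hrank (v l : Fin V) : Measurable fun ξ : Key V => ξ.1 v ≤ ξ.1 l :=
    (measurable_of_countable fun π : Equiv.Perm (Fin V) => π v ≤ π l).comp measurable_fst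
  refine measurable_to_countable' fun v => ?_
  simp only [Set.preimage, Set.mem_singleton_iff, decode_eq_iff]
  exact ((hadmissible v).and (.forall fun l => (hadmissible l).imp (hrank v l))).setOf

variable {n : ℕ} (p : LanguageModel V) (prompt : List (Fin V)) (y : Fin n → Fin V)

/-- The keys that decode to the token `y i` once the prompt and the tokens of `y` before `i` have
been produced. -/
def tokenEvent (i : Fin n) : Set (Key V) :=
  {ξ | decode ξ (p (prompt ++ List.ofFn fun j : Fin i.val => y ⟨j.val, j.isLt.trans i.isLt⟩))
    = y i}

/-- The law of the `i`-th key conditioned on producing the `i`-th token of `y`. These are the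
conditional laws of the keys given the prompt and the generated text `y`. -/
def condKeyLaw (i : Fin n) : Measure (Key V) :=
  (keyLaw V)[|tokenEvent p prompt y i]

theorem measurableSet_tokenEvent (i : Fin n) : MeasurableSet (tokenEvent p prompt y i) :=
  measurable_decode _ (measurableSet_singleton _)

theorem generate_eq_iff (ξ : Fin n → Key V) :
    generate p prompt ξ = y ↔ ∀ i, ξ i ∈ tokenEvent p prompt y i := by
  refine ⟨?_, fun h => funext fun i => ?_⟩
  · rintro rfl i
    simp only [tokenEvent, Set.mem_ofPred_eq]
    rw [generate]
  · induction i using WellFoundedLT.induction with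
    | ind i ih =>
      have hpast : (fun j : Fin i.val => generate p prompt ξ ⟨j.val, j.isLt.trans i.isLt⟩) =
          fun j : Fin i.val => y ⟨j.val, j.isLt.trans i.isLt⟩ := funext fun j => ih _ j.isLt
      rw [generate, hpast]
      exact h i

theorem preimage_generate_singleton :
    generate p prompt ⁻¹' {y} = Set.univ.pi (tokenEvent p prompt y) := by
  ext ξ
  simp only [Set.mem_preimage, Set.mem_singleton_iff, generate_eq_iff, Set.mem_univ_pi]

theorem cond_generate_eq_pi_condKeyLaw :
    (Measure.pi fun _ => keyLaw V)[|generate p prompt ← y] =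
      Measure.pi (condKeyLaw p prompt y) := by
  rw [preimage_generate_singleton]
  exact cond_pi_univ_pi _ (measurableSet_tokenEvent p prompt y)

theorem isProbabilityMeasure_condKeyLaw
    (h : (Measure.pi fun _ => keyLaw V) (generate p prompt ⁻¹' {y}) ≠ 0) (i : Fin n) :
    IsProbabilityMeasure (condKeyLaw p prompt y i) := by
  rw [preimage_generate_singleton, Measure.pi_pi, Finset.prod_ne_zero_iff] at h
  exact cond_isProbabilityMeasure (h i (Finset.mem_univ i))

end Generate

namespace Experiment

variable {V : ℕ} (E : Experiment V) (p : LanguageModel V)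

instance : IsProbabilityMeasure E.prob := by
  unfold prob; infer_instance

/-- The prompt and the generated text. They determine the published text and the weights. -/
def transcript (ω : E.Sample) : (Fin (E.n₀ + 1) → Fin V) × (Fin E.n → Fin V) :=
  (ω.1, E.text p ω)

theorem preimage_transcript_singleton (x : Fin (E.n₀ + 1) → Fin V) (y : Fin E.n → Fin V) :
    E.transcript p ⁻¹' {(x, y)} =
      {x} ×ˢ ((generate p (List.ofFn x) ⁻¹' {y}) ×ˢ Set.univ) := by
  ext ⟨x', ξ, ξ'⟩
  simp only [transcript, text, Set.mem_preimage, Set.mem_singleton_iff, Prod.mk.injEq,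
    Set.mem_prod, Set.mem_univ, and_true]
  exact and_congr_right fun hx => by rw [hx]

theorem measurable_transcript : Measurable (E.transcript p) := by
  refine measurable_to_countable' fun ⟨x, y⟩ => ?_
  rw [preimage_transcript_singleton, preimage_generate_singleton]
  exact (measurableSet_singleton x).prod
    ((MeasurableSet.univ_pi (measurableSet_tokenEvent p _ y)).prod MeasurableSet.univ)

theorem measurable_of_transcript {α : Type*} [MeasurableSpace α]
    (f : (Fin (E.n₀ + 1) → Fin V) × (Fin E.n → Fin V) → α) :
    Measurable fun ω => f (E.transcript p ω) :=
  (measurable_of_countable f).comp (E.measurable_transcript p)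

theorem measurable_published : Measurable (E.published p) :=
  E.measurable_of_transcript p fun z => E.edit z.1 z.2

theorem measurable_weights : Measurable (E.weights p) :=
  E.measurable_of_transcript p fun z => E.weight z.1 z.2

theorem measurable_fullInfo_map :
    @Measurable _ _ _ ⊤ fun ω : E.Sample => (E.published p ω, ω.1, E.text p ω) :=
  letI : MeasurableSpace ((Fin E.m → Fin V) × (Fin (E.n₀ + 1) → Fin V) × (Fin E.n → Fin V)) := ⊤
  E.measurable_of_transcript p fun z => (E.edit z.1 z.2, z.1, z.2)

theorem publicInfo_le : E.publicInfo p ≤ inferInstanceAs (MeasurableSpace E.Sample) :=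
  letI : MeasurableSpace ((Fin (E.n₀ + 1) → Fin V) × (Fin E.m → Fin V)) := ⊤
  (E.measurable_of_transcript p fun z => (z.1, E.edit z.1 z.2)).comap_le

theorem cond_transcript_eq_prod (x : Fin (E.n₀ + 1) → Fin V) (y : Fin E.n → Fin V) :
    E.prob[|E.transcript p ← (x, y)] = (E.promptLaw.toMeasure[|{x}]).prod
      ((Measure.pi (condKeyLaw p (List.ofFn x) y)).prod
        (Measure.pi fun _ => Measure.pi fun _ => keyLaw V)) := by
  rw [preimage_transcript_singleton, prob, cond_prod_prod, cond_prod_prod,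
    cond_generate_eq_pi_condKeyLaw, cond_univ]

section Conditional

variable {E p} {x : Fin (E.n₀ + 1) → Fin V} {y : Fin E.n → Fin V}
  (h : E.prob (E.transcript p ⁻¹' {(x, y)}) ≠ 0)

include h

theorem prob_transcript_ne_zero : E.promptLaw.toMeasure {x} ≠ 0 ∧
    (Measure.pi fun _ => keyLaw V) (generate p (List.ofFn x) ⁻¹' {y}) ≠ 0 := by
  rw [preimage_transcript_singleton, prob, Measure.prod_prod, Measure.prod_prod] at h
  exact ⟨left_ne_zero_of_mul h, left_ne_zero_of_mul (right_ne_zero_of_mul h)⟩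

theorem measurePreserving_key_cond_transcript :
    MeasurePreserving (fun ω : E.Sample => ω.2.1) (E.prob[|E.transcript p ← (x, y)])
      (Measure.pi (condKeyLaw p (List.ofFn x) y)) := by
  have := cond_isProbabilityMeasure (prob_transcript_ne_zero h).1
  have := isProbabilityMeasure_condKeyLaw p _ y (prob_transcript_ne_zero h).2
  rw [cond_transcript_eq_prod]
  exact measurePreserving_fst.comp measurePreserving_snd

theorem measurePreserving_fresh_cond_transcript (t : Fin E.T) :
    MeasurePreserving (fun ω : E.Sample => ω.2.2 t) (E.prob[|E.transcript p ← (x, y)])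
      (Measure.pi fun _ => keyLaw V) := by
  have := cond_isProbabilityMeasure (prob_transcript_ne_zero h).1
  have := isProbabilityMeasure_condKeyLaw p _ y (prob_transcript_ne_zero h).2
  rw [cond_transcript_eq_prod]
  exact (measurePreserving_eval _ t).comp (measurePreserving_snd.comp measurePreserving_snd)

end Conditional

section WindowStat

variable {Ω : Type*} [MeasurableSpace Ω] {w : Ω → Fin E.n → ℝ} {ξ : Ω → Fin E.n → Key V}
  {y : Ω → Fin E.m → Fin V} (hw : Measurable w) (hξ : Measurable ξ) (hy : Measurable y)

include hw hξ hy

theorem measurable_windowStat (a : Fin (E.n - E.B + 1)) (b : Fin (E.m - E.B + 1)) :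
    Measurable fun ω => E.windowStat (w ω) (ξ ω) (y ω) a b := by
  simp only [windowStat, weightedStat_eq, window]
  exact (Finset.measurable_fun_sum _ fun i _ =>
    hw.eval.mul (measurable_tokenScore hy.eval hξ.eval)).const_mul _

theorem measurable_maxStat : Measurable fun ω => E.maxStat (w ω) (ξ ω) (y ω) := by
  have hsup := Finset.measurable_sup' Finset.univ_nonempty
    fun (ab : Fin (E.n - E.B + 1) × Fin (E.m - E.B + 1)) _ =>
      E.measurable_windowStat hw hξ hy ab.1 ab.2
  convert hsup using 1
  ext ω
  simp only [maxStat, Finset.sup'_apply]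

end WindowStat

theorem ae_cond_transcript (ω : E.Sample) : ∀ᵐ ω' ∂E.prob[|E.transcript p ← E.transcript p ω],
    E.weights p ω' = E.weights p ω ∧ E.published p ω' = E.published p ω := by
  filter_upwards [ae_cond_mem (E.measurable_transcript p (measurableSet_singleton _))] with ω' hω'
  obtain ⟨hx, hy⟩ := Prod.mk.inj (Set.mem_singleton_iff.1 hω')
  simp only [weights, published, hx, hy, and_self]

theorem integrable_windowStat (a : Fin (E.n - E.B + 1)) (b : Fin (E.m - E.B + 1)) :
    Integrable (fun ω => E.windowStat (E.weights p ω) ω.2.1 (E.published p ω) a b) E.prob := by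
  have hweight (i : Fin E.n) : Integrable (fun ω => E.weights p ω i) E.prob :=
    (Integrable.of_finite (f := fun z : (Fin (E.n₀ + 1) → Fin V) × (Fin E.n → Fin V) =>
      E.weight z.1 z.2 i)).comp_measurable (E.measurable_transcript p)
  simp only [windowStat, weightedStat_eq, window]
  refine (integrable_finsetSum _ fun i _ => ?_).const_mul _
  exact (hweight _).mul_bdd (measurable_tokenScore (E.measurable_published p).eval
    measurable_snd.fst.eval).aestronglyMeasurable (ae_of_all _ fun _ => abs_tokenScore_le _ _)

theorem condExp_windowStat_apply {ω : E.Sample}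
    (hω : E.prob (E.transcript p ⁻¹' {E.transcript p ω}) ≠ 0)
    (a : Fin (E.n - E.B + 1)) (b : Fin (E.m - E.B + 1)) :
    (E.prob[fun ω' => E.windowStat (E.weights p ω') ω'.2.1 (E.published p ω') a b
      | E.fullInfo p]) ω =
      ∫ ξ, E.windowStat (E.weights p ω) ξ (E.published p ω) a b
        ∂Measure.pi (condKeyLaw p (List.ofFn ω.1) (E.text p ω)) := by
  have hfibre : (fun ω' => (E.published p ω', ω'.1, E.text p ω')) ⁻¹'
      {(E.published p ω, ω.1, E.text p ω)} = E.transcript p ⁻¹' {E.transcript p ω} := by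
    ext ω'
    simp only [Set.mem_preimage, Set.mem_singleton_iff, transcript, Prod.mk.injEq,
      and_iff_right_iff_imp, published]
    rintro ⟨hx, hy⟩
    rw [hx, hy]
  have hae : ∀ᵐ ω' ∂E.prob[|E.transcript p ← E.transcript p ω],
      E.windowStat (E.weights p ω') ω'.2.1 (E.published p ω') a b =
        E.windowStat (E.weights p ω) ω'.2.1 (E.published p ω) a b :=
    (E.ae_cond_transcript p ω).mono fun ω' ⟨hw, hy⟩ => by rw [hw, hy]
  have hkey : HasLaw (fun ω' : E.Sample => ω'.2.1) _ (E.prob[|E.transcript p ← E.transcript p ω]) :=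
    (measurePreserving_key_cond_transcript hω).hasLaw
  rw [condExp_comap_apply (mα := ⊤) (E.measurable_fullInfo_map p) (E.integrable_windowStat p a b)
    (by rwa [hfibre]), hfibre, integral_congr_ae hae]
  exact hkey.integral_comp (E.measurable_windowStat measurable_const
    measurable_id measurable_const a b).aestronglyMeasurable

section Tail

theorem hasSubgaussianMGF_windowStat (μ : Fin E.n → Measure (Key V))
    [∀ i, IsProbabilityMeasure (μ i)] {w : Fin E.n → ℝ} {W : NNReal} (hw : ∀ i, |w i| ≤ W)
    (y : Fin E.m → Fin V) (a : Fin (E.n - E.B + 1)) (b : Fin (E.m - E.B + 1)) :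
    HasSubgaussianMGF
      (fun ξ => E.windowStat w ξ y a b - ∫ ξ', E.windowStat w ξ' y a b ∂Measure.pi μ)
      (W ^ 2 / (16 * E.B)) (Measure.pi μ) := by
  have hind : iIndepFun (fun i (ξ : Fin E.n → Key V) => ξ i) (Measure.pi μ) :=
    iIndepFun_pi (X := fun _ k => k) fun _ => aemeasurable_id
  have hinj : Function.Injective (window E.B_le_n a id) := fun i j hij => by
    simpa [window, Fin.ext_iff] using hij
  exact hasSubgaussianMGF_weightedStat
    (ξ := fun i (k : Fin E.n → Key V) => k (window E.B_le_n a id i))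
    (fun _ => measurable_pi_apply _) (hind.precomp hinj) (fun _ => hw _) (window E.B_le_m b y)

theorem integral_windowStat_keyLaw (w : Fin E.n → ℝ) (y : Fin E.m → Fin V)
    (a : Fin (E.n - E.B + 1)) (b : Fin (E.m - E.B + 1)) :
    ∫ ξ, E.windowStat w ξ y a b ∂(Measure.pi fun _ => keyLaw V) = 0 :=
  integral_weightedStat_of_hasLaw_keyLaw
    (fun _ => (measurePreserving_eval (fun _ : Fin E.n => keyLaw V) _).hasLaw) _ _

variable {w : Fin E.n → ℝ} {W : NNReal} (hW : W ≠ 0) (hw : ∀ i, |w i| ≤ W) {L : ℝ} (hL : 0 ≤ L)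
  (y : Fin E.m → Fin V)

include hW hw hL

theorem measureReal_windowStat_le_mean_sub (μ : Fin E.n → Measure (Key V))
    [∀ i, IsProbabilityMeasure (μ i)] (a : Fin (E.n - E.B + 1)) (b : Fin (E.m - E.B + 1)) :
    (Measure.pi μ).real {ξ | E.windowStat w ξ y a b ≤
      ∫ ξ', E.windowStat w ξ' y a b ∂Measure.pi μ - W * √(L / E.B)} ≤ Real.exp (-(8 * L)) := by
  refine (measureReal_mono fun ξ hξ => ?_).trans (measureReal_ge_le_of_hasSubgaussianMGF
    (E.hasSubgaussianMGF_windowStat μ hw y a b).neg hW (Nat.one_le_iff_ne_zero.1 E.one_le_B) hL)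
  simp only [Set.mem_ofPred_eq, Pi.neg_apply] at hξ ⊢
  linarith

theorem measureReal_le_maxStat_keyLaw :
    (Measure.pi fun _ => keyLaw V).real {ξ | W * √(L / E.B) ≤ E.maxStat w ξ y} ≤
      (max E.n E.m : ℕ) ^ 2 * Real.exp (-(8 * L)) := by
  have htail (ab : Fin (E.n - E.B + 1) × Fin (E.m - E.B + 1)) :
      (Measure.pi fun _ => keyLaw V).real {ξ | W * √(L / E.B) ≤ E.windowStat w ξ y ab.1 ab.2} ≤
        Real.exp (-(8 * L)) := by
    have h := E.hasSubgaussianMGF_windowStat (fun _ => keyLaw V) hw y ab.1 ab.2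
    simp only [integral_windowStat_keyLaw, sub_zero] at h
    exact measureReal_ge_le_of_hasSubgaussianMGF h hW (Nat.one_le_iff_ne_zero.1 E.one_le_B) hL
  have hcard : Fintype.card (Fin (E.n - E.B + 1) × Fin (E.m - E.B + 1)) ≤ max E.n E.m ^ 2 := by
    have := E.one_le_B
    have := E.B_le_n
    have := E.B_le_m
    rw [Fintype.card_prod, Fintype.card_fin, Fintype.card_fin, sq]
    gcongr <;> omega
  have hunion : {ξ | W * √(L / E.B) ≤ E.maxStat w ξ y} =
      ⋃ ab : Fin (E.n - E.B + 1) × Fin (E.m - E.B + 1),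
        {ξ | W * √(L / E.B) ≤ E.windowStat w ξ y ab.1 ab.2} := by
    ext ξ
    simp only [maxStat, Set.mem_ofPred_eq, Finset.le_sup'_iff, Finset.mem_univ, true_and,
      Set.mem_iUnion]
  calc _ ≤ ∑ _ : Fin (E.n - E.B + 1) × Fin (E.m - E.B + 1), Real.exp (-(8 * L)) := by
        rw [hunion]
        exact (measureReal_iUnion_fintype_le _).trans (Finset.sum_le_sum fun ab _ => htail ab)
    _ ≤ (max E.n E.m : ℕ) ^ 2 * Real.exp (-(8 * L)) := by
        rw [Finset.sum_const, nsmul_eq_mul, Finset.card_univ]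
        gcongr
        exact_mod_cast hcard

end Tail

theorem abs_weights_le_sqrt_omegaMax (ω : E.Sample) (i : Fin E.n) :
    |E.weights p ω i| ≤ √(E.omegaMax p ω) :=
  Real.abs_le_sqrt (Finset.le_sup' (fun i => E.weights p ω i ^ 2) (Finset.mem_univ i))

theorem exists_two_mul_scale_lt_integral_windowStat {ω : E.Sample}
    (hω : E.prob (E.transcript p ⁻¹' {E.transcript p ω}) ≠ 0)
    (hscale : 0 < E.scale p ω) (hsignal : 2 < (E.scale p ω)⁻¹ * E.maxCondMean p ω) :
    ∃ a b, 2 * E.scale p ω < ∫ ξ, E.windowStat (E.weights p ω) ξ (E.published p ω) a b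
      ∂Measure.pi (condKeyLaw p (List.ofFn ω.1) (E.text p ω)) := by
  rw [lt_inv_mul_iff₀' hscale, maxCondMean, Finset.lt_sup'_iff] at hsignal
  obtain ⟨⟨a, b⟩, -, hab⟩ := hsignal
  exact ⟨a, b, hab.trans_eq (E.condExp_windowStat_apply p hω a b)⟩

/-- The event that the `t`-th fresh key sequence scores at least as high as the true one. -/
def exceedEvent (t : Fin E.T) : Set E.Sample :=
  {ω | E.maxStat (E.weights p ω) ω.2.1 (E.published p ω) ≤
    E.maxStat (E.weights p ω) (ω.2.2 t) (E.published p ω)}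

theorem measurableSet_exceedEvent (t : Fin E.T) : MeasurableSet (E.exceedEvent p t) :=
  measurableSet_le
    (E.measurable_maxStat (E.measurable_weights p) measurable_snd.fst (E.measurable_published p))
    (E.measurable_maxStat (E.measurable_weights p) measurable_snd.snd.eval
      (E.measurable_published p))

theorem scale_nonneg (ω : E.Sample) : 0 ≤ E.scale p ω :=
  mul_nonneg (Real.sqrt_nonneg _) (Real.sqrt_nonneg _)

theorem windowStat_le_maxStat (w : Fin E.n → ℝ) (ξ : Fin E.n → Key V) (y : Fin E.m → Fin V)
    (a : Fin (E.n - E.B + 1)) (b : Fin (E.m - E.B + 1)) :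
    E.windowStat w ξ y a b ≤ E.maxStat w ξ y :=
  Finset.le_sup' (fun ab : Fin (E.n - E.B + 1) × Fin (E.m - E.B + 1) =>
    E.windowStat w ξ y ab.1 ab.2) (Finset.mem_univ (a, b))

theorem ae_windowStat_le_or_le_maxStat_of_mem_exceedEvent (ω : E.Sample) (t : Fin E.T)
    (a : Fin (E.n - E.B + 1)) (b : Fin (E.m - E.B + 1)) (r : ℝ) :
    ∀ᵐ ω' ∂E.prob[|E.transcript p ← E.transcript p ω], ω' ∈ E.exceedEvent p t →
      E.windowStat (E.weights p ω) ω'.2.1 (E.published p ω) a b ≤ r ∨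
        r ≤ E.maxStat (E.weights p ω) (ω'.2.2 t) (E.published p ω) := by
  filter_upwards [E.ae_cond_transcript p ω] with ω' ⟨hw, hy⟩ hexceed
  rw [← hw, ← hy]
  exact (le_total _ r).imp_left ((E.windowStat_le_maxStat _ _ _ a b).trans hexceed).trans

theorem measureReal_cond_exceedEvent_le_of_integral {ω : E.Sample}
    (hω : E.prob (E.transcript p ⁻¹' {E.transcript p ω}) ≠ 0) (hscale : 0 < E.scale p ω)
    {a : Fin (E.n - E.B + 1)} {b : Fin (E.m - E.B + 1)}
    (hmean : 2 * E.scale p ω < ∫ ξ, E.windowStat (E.weights p ω) ξ (E.published p ω) a b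
      ∂Measure.pi (condKeyLaw p (List.ofFn ω.1) (E.text p ω))) (t : Fin E.T) :
    (E.prob[|E.transcript p ← E.transcript p ω]).real (E.exceedEvent p t) ≤ 2 / E.n := by
  have := isProbabilityMeasure_condKeyLaw p _ _ (prob_transcript_ne_zero hω).2
  have := cond_isProbabilityMeasure hω
  let w := E.weights p ω
  let y := E.published p ω
  let μ := condKeyLaw p (List.ofFn ω.1) (E.text p ω)
  let lowTrue : Set (Fin E.n → Key V) := {ξ | E.windowStat w ξ y a b ≤
    ∫ ξ', E.windowStat w ξ' y a b ∂Measure.pi μ - E.scale p ω}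
  let highFresh : Set (Fin E.n → Key V) := {ξ | E.scale p ω ≤ E.maxStat w ξ y}
  have hlow_meas : MeasurableSet lowTrue := measurableSet_le
    (E.measurable_windowStat measurable_const measurable_id measurable_const a b) measurable_const
  have hhigh_meas : MeasurableSet highFresh := measurableSet_le measurable_const
    (E.measurable_maxStat measurable_const measurable_id measurable_const)
  have hsub : E.exceedEvent p t ≤ᵐ[E.prob[|E.transcript p ← E.transcript p ω]]
      ((fun ω' => ω'.2.1) ⁻¹' lowTrue ∪ (fun ω' => ω'.2.2 t) ⁻¹' highFresh : Set E.Sample) :=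
    (E.ae_windowStat_le_or_le_maxStat_of_mem_exceedEvent p ω t a b _).mono fun ω' h hexceed =>
      (h hexceed).imp_right (le_trans (by linarith))
  let W : NNReal := ⟨√(E.omegaMax p ω), Real.sqrt_nonneg _⟩
  have hW : W ≠ 0 := fun h => (left_ne_zero_of_mul hscale.ne') (congrArg NNReal.toReal h)
  have hlog : 0 ≤ Real.log (max E.n E.m : ℕ) := Real.log_natCast_nonneg _
  calc _ ≤ (E.prob[|E.transcript p ← E.transcript p ω]).real
          ((fun ω' => ω'.2.1) ⁻¹' lowTrue ∪ (fun ω' => ω'.2.2 t) ⁻¹' highFresh) :=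
        ENNReal.toReal_mono (measure_ne_top _ _) (measure_mono_ae hsub)
    _ ≤ (Measure.pi μ).real lowTrue + (Measure.pi fun _ => keyLaw V).real highFresh := by
        rw [← (measurePreserving_key_cond_transcript hω).measureReal_preimage
          hlow_meas.nullMeasurableSet, ← (measurePreserving_fresh_cond_transcript hω
          t).measureReal_preimage hhigh_meas.nullMeasurableSet]
        exact measureReal_union_le _ _
    _ ≤ _ := add_le_add
        (E.measureReal_windowStat_le_mean_sub hW (E.abs_weights_le_sqrt_omegaMax p ω) hlog y μ a b)
        (E.measureReal_le_maxStat_keyLaw hW (E.abs_weights_le_sqrt_omegaMax p ω) hlog y)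
    _ ≤ 2 / E.n := exp_neg_eight_mul_log_add_le (E.one_le_B.trans E.B_le_n) (le_max_left _ _)

theorem measureReal_cond_exceedEvent_le {ω : E.Sample}
    (hω : E.prob (E.transcript p ⁻¹' {E.transcript p ω}) ≠ 0)
    (hsignal : 2 < (E.scale p ω)⁻¹ * E.maxCondMean p ω) (t : Fin E.T) :
    (E.prob[|E.transcript p ← E.transcript p ω]).real (E.exceedEvent p t) ≤ 2 / E.n := by
  have hscale : 0 < E.scale p ω := by
    refine (E.scale_nonneg p ω).lt_of_ne fun h => ?_
    rw [← h, inv_zero, zero_mul] at hsignal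
    linarith
  obtain ⟨a, b, hmean⟩ := E.exists_two_mul_scale_lt_integral_windowStat p hω hscale hsignal
  exact E.measureReal_cond_exceedEvent_le_of_integral p hω hscale hmean t

theorem measureReal_exceedEvent_le (t : Fin E.T) : E.prob.real (E.exceedEvent p t) ≤
    E.prob.real {ω | (E.scale p ω)⁻¹ * E.maxCondMean p ω ≤ 2} + 2 / E.n :=
  measureReal_le_add_of_cond_fiber_le (E.measurable_transcript p) (by positivity)
    fun _ hsignal hω => E.measureReal_cond_exceedEvent_le p hω (not_le.1 hsignal) t

theorem pValue_eq (ω : E.Sample) : E.pValue p ω = 1 / ((E.T : ℝ) + 1) *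
    (1 + ∑ t : Fin E.T, (E.exceedEvent p t).indicator (fun _ => (1 : ℝ)) ω) := by
  classical
  simp only [pValue, exceedEvent, Set.indicator_apply, Set.mem_ofPred_eq]

theorem measurableSet_pValue_le (α : ℝ) : MeasurableSet {ω | E.pValue p ω ≤ α} := by
  simp only [pValue_eq]
  exact measurableSet_le (((Finset.measurable_fun_sum _ fun t _ => measurable_const.indicator
    (E.measurableSet_exceedEvent p t)).const_add _).const_mul _) measurable_const

theorem le_sum_indicator_exceedEvent_of_lt_pValue {α : ℝ} (hT : 1 ≤ α * (E.T + 1))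
    {ω : E.Sample} (hω : α < E.pValue p ω) :
    α * (E.T + 1) / 2 ≤ ∑ t, (E.exceedEvent p t).indicator (fun _ => (1 : ℝ)) ω := by
  classical
  have hcount : ∑ t, (E.exceedEvent p t).indicator (fun _ => (1 : ℝ)) ω =
      (Finset.univ.filter fun t => ω ∈ E.exceedEvent p t).card := by
    simp only [Set.indicator_apply, Finset.sum_boole]
  rw [pValue_eq, one_div_mul_eq_div, lt_div_iff₀ (by positivity), hcount] at hω
  rw [hcount]
  have hcount_pos : (1 : ℝ) ≤ (Finset.univ.filter fun t => ω ∈ E.exceedEvent p t).card := by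
    exact_mod_cast Nat.one_le_iff_ne_zero.2 fun h => by rw [h] at hω; norm_num at hω; linarith
  linarith

theorem measureReal_pValue_le_compl_le {α r : ℝ} (hα : 0 < α) (hT : 1 ≤ α * (E.T + 1))
    (hr : 0 ≤ r) (h : ∀ t, E.prob.real (E.exceedEvent p t) ≤ r) :
    E.prob.real {ω | E.pValue p ω ≤ α}ᶜ ≤ 2 / α * r := by
  have hsub : {ω | E.pValue p ω ≤ α}ᶜ ⊆ {ω | α * (E.T + 1) / 2 ≤
      ∑ t, (E.exceedEvent p t).indicator (fun _ => (1 : ℝ)) ω} := fun ω hω =>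
    E.le_sum_indicator_exceedEvent_of_lt_pValue p hT (not_le.1 hω)
  have hmarkov : α * (E.T + 1) / 2 * E.prob.real {ω | E.pValue p ω ≤ α}ᶜ ≤ (E.T + 1) * r :=
    calc _ ≤ _ := mul_le_mul_of_nonneg_left (measureReal_mono hsub) (by linarith)
      _ ≤ ∑ t, E.prob.real (E.exceedEvent p t) :=
        mul_measureReal_le_sum_indicator_le (E.measurableSet_exceedEvent p) _
      _ ≤ ∑ _ : Fin E.T, r := Finset.sum_le_sum fun t _ => h t
      _ ≤ (E.T + 1) * r := by
        rw [Finset.sum_const, Finset.card_univ, Fintype.card_fin, nsmul_eq_mul]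
        linarith
  rw [div_mul_eq_mul_div, le_div_iff₀ hα]
  refine le_of_mul_le_mul_left ?_ (by positivity : (0 : ℝ) < E.T + 1)
  linarith

theorem measureReal_condPower_lt_le {α δ : ℝ} (hα : 0 < α) (hT : 1 ≤ α * (E.T + 1))
    (hδ : 0 < δ) : E.prob.real {ω | E.condPower p α ω < 1 - δ} ≤
      2 / α * (E.prob.real {ω | (E.scale p ω)⁻¹ * E.maxCondMean p ω ≤ 2} + 2 / E.n) / δ :=
  (measureReal_condProb_lt_one_sub_le (E.publicInfo_le p) (E.measurableSet_pValue_le p α) hδ).trans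
    (div_le_div_of_nonneg_right (E.measureReal_pValue_le_compl_le p hα hT (by positivity)
      (E.measureReal_exceedEvent_le p)) hδ.le)

theorem ae_condPower_nonneg (α : ℝ) : ∀ᵐ ω ∂E.prob, 0 ≤ E.condPower p α ω :=
  condExp_nonneg (ae_of_all _ fun _ => Set.indicator_nonneg (fun _ _ => zero_le_one) _)

section Sequence

variable {ι : Type*} {l : Filter ι} {V : ι → ℕ} {p : ∀ k, LanguageModel (V k)}
  {E : ∀ k, Experiment (V k)}

theorem tendsto_prob_condPower_lt_one_sub {α δ : ℝ} (hα : 0 < α) (hδ : 0 < δ)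
    (hn : Tendsto (fun k => (E k).n) l atTop) (hT : ∀ᶠ k in l, 1 ≤ α * ((E k).T + 1))
    (hsignal : Tendsto (fun k =>
      (E k).prob {ω | ((E k).scale (p k) ω)⁻¹ * (E k).maxCondMean (p k) ω ≤ 2}) l (𝓝 0)) :
    Tendsto (fun k => (E k).prob {ω | (E k).condPower (p k) α ω < 1 - δ}) l (𝓝 0) := by
  have hweak : Tendsto (fun k => (E k).prob.real
      {ω | ((E k).scale (p k) ω)⁻¹ * (E k).maxCondMean (p k) ω ≤ 2}) l (𝓝 0) :=
    (ENNReal.tendsto_toReal ENNReal.zero_ne_top).comp hsignal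
  have hn_inv : Tendsto (fun k => 2 / ((E k).n : ℝ)) l (𝓝 0) :=
    (tendsto_const_div_atTop_nhds_zero_nat 2).comp hn
  have hbound : Tendsto (fun k => 2 / α * ((E k).prob.real
      {ω | ((E k).scale (p k) ω)⁻¹ * (E k).maxCondMean (p k) ω ≤ 2} + 2 / (E k).n) / δ)
      l (𝓝 0) := by
    simpa only [add_zero, mul_zero, zero_div] using
      ((hweak.add hn_inv).const_mul (2 / α)).div_const δ
  rw [← ENNReal.tendsto_toReal_zero_iff fun _ => measure_ne_top _ _]
  exact squeeze_zero' (.of_forall fun _ => measureReal_nonneg)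
    (hT.mono fun k hk => (E k).measureReal_condPower_lt_le (p k) hα hk hδ) hbound

theorem tendsto_prob_condPower_lt_sub {α δ : ℝ} (hα : 0 < α) (hδ : 0 < δ) {c : ι → ℝ}
    (hc : ∀ k, c k ≤ 1) (hcT : ∀ᶠ k in l, α * ((E k).T + 1) < 1 → c k ≤ 0)
    (hn : Tendsto (fun k => (E k).n) l atTop)
    (hsignal : Tendsto (fun k =>
      (E k).prob {ω | ((E k).scale (p k) ω)⁻¹ * (E k).maxCondMean (p k) ω ≤ 2}) l (𝓝 0)) :
    Tendsto (fun k => (E k).prob {ω | (E k).condPower (p k) α ω < c k - δ}) l (𝓝 0) := by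
  let large : Set ι := {k | 1 ≤ α * ((E k).T + 1)}
  have hlarge : Tendsto (fun k => (E k).prob {ω | (E k).condPower (p k) α ω < c k - δ})
      (l ⊓ 𝓟 large) (𝓝 0) :=
    tendsto_of_tendsto_of_tendsto_of_le_of_le tendsto_const_nhds
      (tendsto_prob_condPower_lt_one_sub hα hδ (hn.mono_left inf_le_left)
        (eventually_inf_principal.2 (.of_forall fun _ => id)) (hsignal.mono_left inf_le_left))
      (fun _ => zero_le) fun k => measure_mono fun ω hω => hω.trans_le (sub_le_sub_right (hc k) δ)
  have hsmall : Tendsto (fun k => (E k).prob {ω | (E k).condPower (p k) α ω < c k - δ})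
      (l ⊓ 𝓟 largeᶜ) (𝓝 0) := by
    refine tendsto_nhds_of_eventually_eq (eventually_inf_principal.2 ?_)
    filter_upwards [hcT] with k hk hsmall
    have hck := hk (not_le.1 hsmall)
    refine measure_eq_zero_iff_ae_notMem.2 (((E k).ae_condPower_nonneg (p k) α).mono ?_)
    intro ω hnonneg (hω : (E k).condPower (p k) α ω < c k - δ)
    linarith
  simpa only [← inf_sup_left, sup_principal, Set.union_compl_self, principal_univ, inf_top_eq]
    using hlarge.sup hsmall

end Sequence

end Experiment

/-- The constant of the theorem. It makes the bound vacuous when `α (T + 1) < 1`, where `p_T` always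
exceeds `α`. -/
def powerConst (α ε : ℝ) : ℝ :=
  if ε ≤ 2 * α then 1 else Real.exp (2 * ε ^ 2 / α)

theorem powerConst_pos (α ε : ℝ) : 0 < powerConst α ε := by
  unfold powerConst; split_ifs <;> positivity

theorem one_sub_powerConst_mul_exp_nonpos {α ε T : ℝ} (hα : 0 < α) (hε : 0 < ε)
    (hεT : 2 / ε - 1 < T) (hαT : α * (T + 1) < 1) :
    1 - powerConst α ε * Real.exp (-2 * T * ε ^ 2) ≤ 0 := by
  have hεα : ¬ ε ≤ 2 * α := fun h => by
    have hT : 2 < ε * (T + 1) := by rwa [sub_lt_iff_lt_add, div_lt_iff₀' hε] at hεT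
    nlinarith
  have hTα : T ≤ 1 / α := by
    rw [le_div_iff₀' hα]
    linarith
  rw [powerConst, if_neg hεα, ← Real.exp_add, sub_nonpos, Real.one_le_exp_iff]
  calc (0 : ℝ) ≤ 2 * ε ^ 2 * (1 / α - T) := by
        have := sub_nonneg.2 hTα
        positivity
    _ = 2 * ε ^ 2 / α + -2 * T * ε ^ 2 := by ring

end ITSWatermark

end

theorem mainTheorem1_general {α ε : ℝ} (hα : 0 < α) (hε : 0 < ε) :
    ∃ C₁ : ℝ, 0 < C₁ ∧ (ε ≤ 2 * α → C₁ = 1) ∧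
      ∀ {ι : Type*} {l : Filter ι} {V : ι → ℕ} (_ : ∀ k, 2 ≤ V k)
        (p : ∀ k, ITSWatermark.LanguageModel (V k)) (E : ∀ k, ITSWatermark.Experiment (V k)),
        Tendsto (fun k => (E k).n) l atTop →
        (∀ᶠ k in l, 2 / ε - 1 < ((E k).T : ℝ)) →
        Tendsto (fun k =>
          (E k).prob {ω | ((E k).scale (p k) ω)⁻¹ * (E k).maxCondMean (p k) ω ≤ 2}) l (𝓝 0) →
        ∀ δ : ℝ, 0 < δ → Tendsto
          (fun k => (E k).prob {ω | (E k).condPower (p k) α ω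
            < 1 - C₁ * Real.exp (-2 * ((E k).T : ℝ) * ε ^ 2) - δ})
          l (𝓝 0) := by
  refine ⟨ITSWatermark.powerConst α ε, ITSWatermark.powerConst_pos α ε, fun h => if_pos h, ?_⟩
  intro ι l V _ p E hn hT hsignal δ hδ
  refine ITSWatermark.Experiment.tendsto_prob_condPower_lt_sub hα hδ (fun k => ?_)
    (hT.mono fun k hk => ITSWatermark.one_sub_powerConst_mul_exp_nonpos hα hε hk) hn hsignal
  exact sub_le_self _ (mul_nonneg (ITSWatermark.powerConst_pos α ε).le (Real.exp_nonneg _))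

theorem mainTheorem1 :
    ∃ C₀ : ℝ, 0 < C₀ ∧ ∀ α ε : ℝ, 0 < α → α < 1 → 0 < ε →
      ∃ C₁ : ℝ, 0 < C₁ ∧ (3 * ε < α → C₁ = C₀) ∧
        ∀ (V : ℕ) (_ : 2 ≤ V) (p : ITSWatermark.LanguageModel V)
          (E : ℕ → ITSWatermark.Experiment V),
          Tendsto (fun k => (E k).n) atTop atTop →
          (∀ k, 2 / ε - 1 < ((E k).T : ℝ)) →
          (∀ K : ℝ, Tendsto
            (fun k => (E k).prob {ω | ((E k).scale p ω)⁻¹ * (E k).maxCondMean p ω ≤ K})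
            atTop (𝓝 0)) →
          ∀ δ : ℝ, 0 < δ → Tendsto
            (fun k => (E k).prob {ω | (E k).condPower p α ω
              < 1 - C₁ * Real.exp (-2 * ((E k).T : ℝ) * ε ^ 2) - δ})
            atTop (𝓝 0) := by
  refine ⟨1, one_pos, fun α ε hα _ hε => ?_⟩
  obtain ⟨C₁, hC₁, hC₁_eq, hpower⟩ := mainTheorem1_general hα hε
  exact ⟨C₁, hC₁, fun h => hC₁_eq (by linarith), fun V hV p E hn hT hmean =>
    hpower (fun _ => hV) (fun _ => p) E hn (.of_forall hT) (hmean 2)⟩
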